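/- For $n\ge 1$ let the kissing number $k(n)$ be the maximum number of pairwise non-overlapping unit balls in $\mathbb R^n$ that touch a central unit ball without overlapping it. A spherical $(n,N,\alpha)$-code is a set of $N$ unit vectors $x_1,\dots,x_N\in\mathbb R^n$ whose pairwise angular distances are at least $\alpha$. For $n\ge 2$ let $G^{(n)}_k$ ($k\ge 0$) be the Gegenbauer polynomials of the sphere $S^{n-1}$, normalized by $G^{(n)}_k(1)=1$, that is, $G^{(n)}_0(t)=1$, $G^{(n)}_1(t)=t$ and $(k+n-1)\,G^{(n)}_{k+2}(t)=(2k+n)\,t\,G^{(n)}_{k+1}(t)-(k+1)\,G^{(n)}_k(t)$. Let $$f_{\pi/3}(t)=\begin{cases}1-2t^2,& t<-\tfrac1{\sqrt2},\\ 0,& -\tfrac1{\sqrt2}\le t\le \tfrac12,\\ 2t-1,& t>\tfrac12.\end{cases}$$ For $n\in\{9,16,17,25,26\}$ let $f_n(t)=c_f\,f_{\pi/3}(t)+\sum_{k=1}^{15}c_k\,G^{(n)}_k(t)$ with the exact coefficients $$\begin{array}{r|lllll} n&9&16&17&25&26\\ \hline c_{1}&0.019301&0.00150625&0.0010991163&0.000068346426&0.000050764918\\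 c_{2}&0.068796&0.00883013&0.0068289424&0.000597204273&0.000462456224\\ c_{3}&0.151621&0.03241271&0.0264586211&0.003278765311&0.002637553785\\ c_{4}&0.233218&0.08357928&0.0719084276&0.012746086882&0.010630533922\\ c_{5}&0.242578&0.15818006&0.143361526&0.03727450386&0.032234603849\\ c_{6}&0.173153&0.22396571&0.2142502303&0.084612203762&0.07583669717\\ c_{7}&0.057219&0.22963948&0.2322459799&0.149967112742&0.139668776208\\ c_{8}&0&0.16129212&0.17372837&0.207792862667&0.20110760134\\ c_{9}&0&0.05703299&0.0656867748&0.213189306323&0.216300884031\\ c_{10}&0.020652&0&0&0.15506047251&0.164792888823\\ c_{11}&0.022367&0&0&0.052419478729&0.062508329517\\ c_{12}&0&0.02211528&0.0310430395&0&0\\ c_{13}&0&0.01792231&0.0309025515&0&0\\ c_{14}&0&0&0&0.038614866776&0.042401423571\\ c_{15}&0&0&0&0.039062690839&0.04958247785\\ c_f&0.008455&0.00340331&0.0024045205&0.005312502853&0.00178248638\\ \end{array}$$ and let $B_9=379$, $B_{16}=8312$, $B_{17}=12210$, $B_{25}=278083$, $B_{26}=396447$. Then for each $n\in\{9,16,17,25,26\}$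 there is a real number $c>0$ with $1/c<B_n+1$ such that (i) $\sum_{i,j=1}^N f_n(\langle x_i,x_j\rangle)\ge 0$ for every $N$ and every spherical $(n,N,\pi/3)$-code $\{x_1,\dots,x_N\}$, (ii) $f_n(t)+c\le 0$ for $-1\le t\le \tfrac12$, and (iii) $f_n(1)+c\le 1$; and the kissing numbers satisfy $k(n)\le B_n$, that is, $k(9)\le 379$, $k(16)\le 8312$, $k(17)\le 12210$, $k(25)\le 278083$ and $k(26)\le 396447$. -/

import Mathlib

open scoped Polynomial

noncomputable section

namespace Kissing

/-- A kissing configuration in `ℝⁿ`, given by the set `C` of centres of its balls: unit balls which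
touch the central unit ball without overlapping it, and which do not overlap each other. -/
def IsKissingConfiguration (n : ℕ) (C : Set (EuclideanSpace ℝ (Fin n))) : Prop :=
  (∀ y ∈ C, (Metric.closedBall y 1 ∩ Metric.closedBall 0 1).Nonempty ∧
    Disjoint (Metric.ball y 1) (Metric.ball 0 1)) ∧
  C.PairwiseDisjoint (fun y => Metric.ball y 1)

/-- The kissing number `k(n)`: the largest number of balls in a kissing configuration in `ℝⁿ`.
It takes values in `ℕ∞`, so that an upper bound on it includes its finiteness. -/
def kissingNumber (n : ℕ) : ℕ∞ :=
  ⨆ (C : Set (EuclideanSpace ℝ (Fin n))) (_ : IsKissingConfiguration n C), C.encard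

/-- A spherical `(n, N, α)`-code: `N` distinct unit vectors in `ℝⁿ` whose pairwise angular distance
is at least `α`. -/
def IsSphericalCode {n N : ℕ} (α : ℝ) (x : Fin N → EuclideanSpace ℝ (Fin n)) : Prop :=
  Function.Injective x ∧ (∀ i, ‖x i‖ = 1) ∧
    ∀ i j, i ≠ j → α ≤ InnerProductGeometry.angle (x i) (x j)

/-- The Gegenbauer polynomial `G_k^{(n)}` for the sphere `S^{n-1}`, `n ≥ 2`, normalized to take the
value `1` at `1`, through its three-term recurrence
`(k + n - 1) G_{k+2} = (2k + n) t G_{k+1} - (k + 1) G_k`. -/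
def gegenbauer (n : ℕ) : ℕ → ℝ[X]
  | 0 => 1
  | 1 => Polynomial.X
  | k + 2 =>
      Polynomial.C ((2 * (k : ℝ) + n) / (k + n - 1)) * Polynomial.X * gegenbauer n (k + 1) -
        Polynomial.C (((k : ℝ) + 1) / (k + n - 1)) * gegenbauer n k

/-- The normalization `G_k^{(n)}(1) = 1`. -/
theorem gegenbauer_eval_one {n : ℕ} (hn : 2 ≤ n) (k : ℕ) : (gegenbauer n k).eval 1 = 1 := by
  have key : ∀ k, (gegenbauer n k).eval 1 = 1 ∧ (gegenbauer n (k + 1)).eval 1 = 1 := by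
    intro k
    induction k with
    | zero => simp [gegenbauer]
    | succ k ih =>
      refine ⟨ih.2, ?_⟩
      have h2 : (2 : ℝ) ≤ n := by exact_mod_cast hn
      have hk : (0 : ℝ) ≤ k := Nat.cast_nonneg k
      have h : (k : ℝ) + n - 1 ≠ 0 := by
        have : (0 : ℝ) < (k : ℝ) + n - 1 := by linarith
        exact this.ne'
      rw [gegenbauer]
      simp only [Polynomial.eval_sub, Polynomial.eval_mul, Polynomial.eval_C, Polynomial.eval_X,
        ih.1, ih.2]
      field_simp
      ring
  exact (key k).1

/-- `G_2^{(n)}(t) = (n t² - 1) / (n - 1)`. -/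
theorem gegenbauer_two_eval (n : ℕ) (t : ℝ) :
    (gegenbauer n 2).eval t = (n * t ^ 2 - 1) / ((n : ℝ) - 1) := by
  simp [gegenbauer]
  ring

/-- The function `f_α`, where `z = cos α`. -/
def fAlpha (α t : ℝ) : ℝ :=
  if t < -Real.sqrt (Real.cos α) then (Real.cos α - t ^ 2) / (1 - Real.cos α)
  else if t ≤ Real.cos α then 0
  else (t - Real.cos α) / (1 - Real.cos α)

/-- The combination `c_f f_{π/3} + ∑_{k=1}^{15} c_k G_k^{(n)}`; the coefficient `c_k` is the entry
`c (k - 1)` of the vector `c`. -/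
def combination (n : ℕ) (cf : ℝ) (c : Fin 15 → ℝ) (t : ℝ) : ℝ :=
  cf * fAlpha (Real.pi / 3) t + ∑ i : Fin 15, c i * (gegenbauer n ((i : ℕ) + 1)).eval t

/-- `f` is a linear programming certificate for the bound `B` on the size of spherical
`(n, N, π/3)`-codes: for some `c > 0` with `1 / c < B + 1`, the sum of `f` over the Gram matrix of
every code is nonnegative, `f + c ≤ 0` on `[-1, cos (π/3)]`, and `f 1 + c ≤ 1`. -/
def IsCertificate (n B : ℕ) (f : ℝ → ℝ) : Prop :=
  ∃ c : ℝ, 0 < c ∧ 1 / c < (B : ℝ) + 1 ∧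
    (∀ (N : ℕ) (x : Fin N → EuclideanSpace ℝ (Fin n)), IsSphericalCode (Real.pi / 3) x →
      0 ≤ ∑ i, ∑ j, f (inner ℝ (x i) (x j))) ∧
    (∀ t ∈ Set.Icc (-1 : ℝ) (Real.cos (Real.pi / 3)), f t + c ≤ 0) ∧
    f 1 + c ≤ 1

/-- The combination used in dimension `9`. -/
def f9 : ℝ → ℝ :=
  combination 9 0.008455
    ![0.019301, 0.068796, 0.151621, 0.233218, 0.242578,
      0.173153, 0.057219, 0, 0, 0.020652,
      0.022367, 0, 0, 0, 0]

/-- The combination used in dimension `16`. -/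
def f16 : ℝ → ℝ :=
  combination 16 0.00340331
    ![0.00150625, 0.00883013, 0.03241271, 0.08357928, 0.15818006,
      0.22396571, 0.22963948, 0.16129212, 0.05703299, 0,
      0, 0.02211528, 0.01792231, 0, 0]

/-- The combination used in dimension `17`. -/
def f17 : ℝ → ℝ :=
  combination 17 0.0024045205
    ![0.0010991163, 0.0068289424, 0.0264586211, 0.0719084276, 0.143361526,
      0.2142502303, 0.2322459799, 0.17372837, 0.0656867748, 0,
      0, 0.0310430395, 0.0309025515, 0, 0]

/-- The combination used in dimension `25`. -/
def f25 : ℝ → ℝ :=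
  combination 25 0.005312502853
    ![0.000068346426, 0.000597204273, 0.003278765311, 0.012746086882, 0.03727450386,
      0.084612203762, 0.149967112742, 0.207792862667, 0.213189306323, 0.15506047251,
      0.052419478729, 0, 0, 0.038614866776, 0.039062690839]

/-- The combination used in dimension `26`. -/
def f26 : ℝ → ℝ :=
  combination 26 0.00178248638
    ![0.000050764918, 0.000462456224, 0.002637553785, 0.010630533922, 0.032234603849,
      0.07583669717, 0.139668776208, 0.20110760134, 0.216300884031, 0.164792888823,
      0.062508329517, 0, 0, 0.042401423571, 0.04958247785]

end Kissing

end

/-! This is Delsarte's linear programming method with one extra, non-polynomial positive function.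
For a code of size `N`, the sum of `f` over the Gram matrix is nonnegative, while `f + c` is at most
1 on the diagonal and at most 0 off it. Hence `N² c ≤ N`, so `N ≤ 1 / c < B + 1`. Halving the
centres of a kissing configuration turns it into a code of angle `π / 3`.

Nonnegativity has two sources. Gegenbauer sums are nonnegative (`sum_gegenbauer_nonneg`) because the
zonal harmonics are, up to a positive factor, reproducing kernels of the harmonic forms for the
Fischer product (`exists_fischer_zonal`); the Gram sum is then a positive multiple of a squared
norm. For `fAlpha`, every row sum is already nonnegative (`sum_fAlpha_nonneg`): the diagonal entry
is 1, and Cauchy-Schwarz bounds the negative entries by 1 in total (`sum_sq_sub_le`).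

The sign condition on `[-1, 1/2]` becomes two inequalities for rational polynomials, one on each
side of `-1/√2`. Exact arithmetic on coefficient lists decides them by bisection and a
Descartes-type test (`isCertificate_of_check`). -/

noncomputable section

namespace Kissing

/-! ### The Fischer inner product -/

section Fischer

open MvPolynomial

variable {σ : Type*}

/-- The Fischer product `p ↦ ⟨p, q⟩`, in which distinct monomials are orthogonal and the monomial
with exponents `m` has squared norm `∏ i, m i !`. -/
def fischer [Fintype σ] (q : MvPolynomial σ ℝ) : MvPolynomial σ ℝ →ₗ[ℝ] ℝ :=
  (basisMonomials σ ℝ).constr ℝ fun m => (∏ i, ((m i).factorial : ℝ)) * coeff m q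

theorem fischer_monomial_one [Fintype σ] (q : MvPolynomial σ ℝ) (m : σ →₀ ℕ) :
    fischer q (monomial m 1) = (∏ i, ((m i).factorial : ℝ)) * coeff m q := by
  have := (basisMonomials σ ℝ).constr_basis ℝ
    (fun m => (∏ i, ((m i).factorial : ℝ)) * coeff m q) m
  simpa [fischer] using this

theorem fischer_self_nonneg [Fintype σ] (q : MvPolynomial σ ℝ) : 0 ≤ fischer q q := by
  have key : fischer q q = ∑ m ∈ q.support, (∏ i, ((m i).factorial : ℝ)) * coeff m q ^ 2 := by
    nth_rewrite 2 [q.as_sum]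
    rw [map_sum]
    refine Finset.sum_congr rfl fun m _ => ?_
    have : monomial m (coeff m q) = coeff m q • monomial m (1 : ℝ) := by simp [smul_monomial]
    rw [this, map_smul, fischer_monomial_one, smul_eq_mul]
    ring
  rw [key]
  positivity

/-- Multiplication by a variable is adjoint to differentiation, because `(m + 1)! = (m + 1) m!`;
this is what the factorial weights are for. Consequently `linForm x` is adjoint to `dirDeriv x`, and
`normSq` to `laplacian`. -/
theorem fischer_X_mul [Fintype σ] (q p : MvPolynomial σ ℝ) (i : σ) :
    fischer q (X i * p) = fischer (pderiv i q) p := by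
  classical
  have : (fischer q).comp (LinearMap.mulLeft ℝ (X i)) = fischer (pderiv i q) := by
    refine (basisMonomials σ ℝ).ext fun m => ?_
    have hm : X i * monomial m (1 : ℝ) = monomial (m + Finsupp.single i 1) 1 := by
      rw [add_comm, monomial_single_add, pow_one]
    simp only [coe_basisMonomials, LinearMap.comp_apply, LinearMap.mulLeft_apply, hm,
      fischer_monomial_one, coeff_pderiv]
    have h : (∏ j, (((m + Finsupp.single i 1 : σ →₀ ℕ) j).factorial : ℝ))
        = (m i + 1) * ∏ j, ((m j).factorial : ℝ) := by
      rw [← Finset.mul_prod_erase _ _ (Finset.mem_univ i),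
        ← Finset.mul_prod_erase _ (fun j => ((m j).factorial : ℝ)) (Finset.mem_univ i), ← mul_assoc]
      congr 1
      · simp [Nat.factorial_succ]
      · refine Finset.prod_congr rfl fun j hj => ?_
        simp [Finsupp.single_eq_of_ne (Finset.ne_of_mem_erase hj)]
    rw [h]
    ring
  exact LinearMap.congr_fun this p

theorem fischer_one [Fintype σ] (q : MvPolynomial σ ℝ) : fischer q 1 = constantCoeff q := by
  have := fischer_monomial_one q 0
  simpa [constantCoeff_eq] using this

theorem fischer_add_left [Fintype σ] (q r p : MvPolynomial σ ℝ) :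
    fischer (q + r) p = fischer q p + fischer r p := by
  have : fischer (q + r) = fischer q + fischer r := by
    refine (basisMonomials σ ℝ).ext fun m => ?_
    simp [fischer_monomial_one, mul_add]
  rw [this, LinearMap.add_apply]

theorem fischer_smul_left [Fintype σ] (c : ℝ) (q p : MvPolynomial σ ℝ) :
    fischer (c • q) p = c * fischer q p := by
  have : fischer (c • q) = c • fischer q := by
    refine (basisMonomials σ ℝ).ext fun m => ?_
    simp [fischer_monomial_one]
    ring
  rw [this, LinearMap.smul_apply, smul_eq_mul]

theorem fischer_sum_left [Fintype σ] {ι : Type*} (s : Finset ι) (q : ι → MvPolynomial σ ℝ)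
    (p : MvPolynomial σ ℝ) : fischer (∑ i ∈ s, q i) p = ∑ i ∈ s, fischer (q i) p := by
  classical
  induction s using Finset.induction_on with
  | empty => simpa using fischer_smul_left 0 0 p
  | insert a s ha ih => rw [Finset.sum_insert ha, Finset.sum_insert ha, fischer_add_left, ih]

theorem pderiv_comm (i j : σ) (p : MvPolynomial σ ℝ) :
    pderiv i (pderiv j p) = pderiv j (pderiv i p) := by
  classical
  -- The commutator of two derivations is a derivation, so it suffices that it kills the variables.
  have : ⁅pderiv (R := ℝ) i, pderiv (R := ℝ) j⁆ = 0 := by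
    refine MvPolynomial.derivation_ext fun k => ?_
    rw [Derivation.commutator_apply]
    simp only [pderiv_X, Pi.single_apply, Derivation.zero_apply]
    split_ifs <;> simp
  have h := congrArg (fun D => D p) this
  simpa [Derivation.commutator_apply, sub_eq_zero] using h

/-- The Laplacian of a polynomial. -/
def laplacian [Fintype σ] : MvPolynomial σ ℝ →ₗ[ℝ] MvPolynomial σ ℝ :=
  ∑ i, (pderiv (R := ℝ) i).toLinearMap.comp (pderiv (R := ℝ) i).toLinearMap

theorem laplacian_apply [Fintype σ] (p : MvPolynomial σ ℝ) :
    laplacian p = ∑ i, pderiv i (pderiv i p) := by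
  simp [laplacian]

/-- The derivative in the direction `x`. -/
def dirDeriv [Fintype σ] (x : σ → ℝ) : Derivation ℝ (MvPolynomial σ ℝ) (MvPolynomial σ ℝ) :=
  ∑ i, x i • pderiv i

theorem dirDeriv_apply [Fintype σ] (x : σ → ℝ) (p : MvPolynomial σ ℝ) :
    dirDeriv x p = ∑ i, x i • pderiv i p := by
  have h : ∀ s : Finset σ, (∑ i ∈ s, x i • pderiv (R := ℝ) i) p = ∑ i ∈ s, x i • pderiv i p := by
    classical
    intro s
    induction s using Finset.induction_on with
    | empty => simp
    | insert a s ha ih => simp [Finset.sum_insert ha, ih]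
  exact h _

/-- The linear form `y ↦ ⟨x, y⟩`. -/
def linForm [Fintype σ] (x : σ → ℝ) : MvPolynomial σ ℝ := ∑ i, x i • X i

/-- The quadratic form `y ↦ ‖y‖²`. -/
def normSq (σ : Type*) [Fintype σ] : MvPolynomial σ ℝ := ∑ i, X i * X i

variable [Fintype σ]

theorem fischer_linForm_mul (x : σ → ℝ) (q p : MvPolynomial σ ℝ) :
    fischer q (linForm x * p) = fischer (dirDeriv x q) p := by
  simp only [linForm, dirDeriv_apply, Finset.sum_mul, map_sum, fischer_sum_left, smul_mul_assoc,
    map_smul, fischer_smul_left, fischer_X_mul, smul_eq_mul]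

theorem fischer_normSq_mul (q p : MvPolynomial σ ℝ) :
    fischer q (normSq σ * p) = fischer (laplacian q) p := by
  simp only [normSq, laplacian_apply, Finset.sum_mul, map_sum, fischer_sum_left, mul_assoc,
    fischer_X_mul]

theorem pderiv_linForm (x : σ → ℝ) (i : σ) : pderiv i (linForm x) = C (x i) := by
  classical
  simp [linForm, pderiv_X, Pi.single_apply, smul_eq_C_mul]

theorem pderiv_normSq (i : σ) : pderiv i (normSq σ) = 2 * X i := by
  classical
  simp [normSq, pderiv_X, Pi.single_apply, Finset.sum_add_distrib]
  ring

theorem dirDeriv_linForm (x : σ → ℝ) : dirDeriv x (linForm x) = C (∑ i, x i ^ 2) := by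
  simp [dirDeriv_apply, pderiv_linForm, smul_eq_C_mul, sq]

theorem dirDeriv_normSq (x : σ → ℝ) : dirDeriv x (normSq σ) = 2 * linForm x := by
  simp [dirDeriv_apply, pderiv_normSq, linForm, Finset.mul_sum]

theorem dirDeriv_laplacian (x : σ → ℝ) (p : MvPolynomial σ ℝ) :
    laplacian (dirDeriv x p) = dirDeriv x (laplacian p) := by
  simp only [laplacian_apply, dirDeriv_apply, map_sum, map_smul, Finset.smul_sum]
  rw [Finset.sum_comm]
  refine Finset.sum_congr rfl fun i _ => Finset.sum_congr rfl fun j _ => ?_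
  rw [pderiv_comm i j p, pderiv_comm i j]

theorem laplacian_linForm_mul (x : σ → ℝ) (p : MvPolynomial σ ℝ) :
    laplacian (linForm x * p) = linForm x * laplacian p + 2 * dirDeriv x p := by
  simp only [laplacian_apply, dirDeriv_apply, pderiv_mul, pderiv_linForm, map_add, pderiv_C,
    Finset.mul_sum, smul_eq_C_mul, ← Finset.sum_add_distrib]
  refine Finset.sum_congr rfl fun i _ => ?_
  ring

theorem laplacian_normSq_mul (p : MvPolynomial σ ℝ) :
    laplacian (normSq σ * p) =
      normSq σ * laplacian p + 4 * ∑ i, X i * pderiv i p + C (2 * (Fintype.card σ : ℝ)) * p := by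
  have hc : C (2 * (Fintype.card σ : ℝ)) * p = ∑ _i : σ, 2 * p := by
    simp [nsmul_eq_mul, mul_comm, mul_left_comm, map_ofNat]
  rw [hc]
  simp only [laplacian_apply, pderiv_mul, pderiv_normSq, map_add,
    Finset.mul_sum, ← Finset.sum_add_distrib]
  refine Finset.sum_congr rfl fun i _ => ?_
  have h2 : pderiv i (2 : MvPolynomial σ ℝ) = 0 := by
    have : (2 : MvPolynomial σ ℝ) = C 2 := (map_ofNat C 2).symm
    rw [this, pderiv_C]
  simp only [pderiv_X_self, h2]
  ring

theorem isHomogeneous_linForm (x : σ → ℝ) : (linForm x).IsHomogeneous 1 := by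
  refine IsHomogeneous.sum _ _ _ fun i _ => ?_
  rw [smul_eq_C_mul]
  simpa using (isHomogeneous_C σ (x i)).mul (isHomogeneous_X ℝ i)

theorem isHomogeneous_normSq : (normSq σ).IsHomogeneous 2 :=
  IsHomogeneous.sum _ _ _ fun i _ => (isHomogeneous_X ℝ i).mul (isHomogeneous_X ℝ i)

theorem isHomogeneous_dirDeriv (x : σ → ℝ) {p : MvPolynomial σ ℝ} {k : ℕ}
    (hp : p.IsHomogeneous (k + 1)) : (dirDeriv x p).IsHomogeneous k := by
  rw [dirDeriv_apply]
  refine IsHomogeneous.sum _ _ _ fun i _ => ?_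
  rw [smul_eq_C_mul]
  simpa using (isHomogeneous_C σ (x i)).mul (hp.pderiv (i := i))

theorem eval_dirDeriv (x : σ → ℝ) {p : MvPolynomial σ ℝ} {k : ℕ} (hp : p.IsHomogeneous k) :
    eval x (dirDeriv x p) = k * eval x p := by
  have := congrArg (eval x) hp.sum_X_mul_pderiv
  simpa [dirDeriv_apply, smul_eval] using this

end Fischer

/-! ### Zonal harmonics and the positive definiteness of the Gegenbauer polynomials -/

section Zonal

open MvPolynomial

/-- The zonal harmonic polynomial of degree `k` with axis `x`, the homogenization of
`y ↦ G_k^{(n)}(⟨x, y⟩)`. -/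
def zonal {n : ℕ} (x : Fin n → ℝ) : ℕ → MvPolynomial (Fin n) ℝ
  | 0 => 1
  | 1 => linForm x
  | k + 2 => C ((2 * (k : ℝ) + n) / (k + n - 1)) * (linForm x * zonal x (k + 1)) -
      C (((k : ℝ) + 1) / (k + n - 1)) * (normSq (Fin n) * zonal x k)

variable {n : ℕ} (x : Fin n → ℝ)

theorem isHomogeneous_zonal : ∀ k, (zonal x k).IsHomogeneous k
  | 0 => isHomogeneous_one _ _
  | 1 => isHomogeneous_linForm x
  | k + 2 => by
    rw [zonal]
    refine IsHomogeneous.sub ?_ ?_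
    · have := (isHomogeneous_C (Fin n) ((2 * (k : ℝ) + n) / (k + n - 1))).mul
        ((isHomogeneous_linForm x).mul (isHomogeneous_zonal (k + 1)))
      rwa [show 0 + (1 + (k + 1)) = k + 2 by ring] at this
    · have := (isHomogeneous_C (Fin n) (((k : ℝ) + 1) / (k + n - 1))).mul
        ((isHomogeneous_normSq (σ := Fin n)).mul (isHomogeneous_zonal k))
      rwa [show 0 + (2 + k) = k + 2 by ring] at this

theorem eval_zonal {y : Fin n → ℝ} (hy : ∑ i, y i ^ 2 = 1) :
    ∀ k, eval y (zonal x k) = (gegenbauer n k).eval (∑ i, x i * y i)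
  | 0 => by simp [zonal, gegenbauer]
  | 1 => by simp [zonal, gegenbauer, linForm, smul_eval]
  | k + 2 => by
    have h1 : eval y (linForm x) = ∑ i, x i * y i := by simp [linForm, smul_eval]
    have h2 : eval y (normSq (Fin n)) = 1 := by simp [normSq, ← hy, sq]
    rw [zonal, gegenbauer]
    simp only [map_sub, map_mul, eval_C, h1, h2, eval_zonal hy (k + 1), eval_zonal hy k,
      Polynomial.eval_sub, Polynomial.eval_mul, Polynomial.eval_C, Polynomial.eval_X]
    ring

/-- Along their axis the zonal harmonics form an Appell sequence. Differentiating the recurrence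
proves this by induction, and harmonicity follows from it. -/
theorem dirDeriv_zonal (hn : 3 ≤ n) (hx : ∑ i, x i ^ 2 = 1) :
    ∀ k, dirDeriv x (zonal x (k + 1)) = C ((k : ℝ) + 1) * zonal x k
  | 0 => by simp [zonal, dirDeriv_linForm, hx]
  | 1 => by
    have hn' : (n : ℝ) - 1 ≠ 0 := by
      have : (3 : ℝ) ≤ n := by exact_mod_cast hn
      linarith
    have e : C ((n : ℝ) / (n - 1)) * 2 - C (1 / ((n : ℝ) - 1)) * 2 =
        (C (1 + 1) : MvPolynomial (Fin n) ℝ) := by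
      have h2 : (2 : MvPolynomial (Fin n) ℝ) = C 2 := (map_ofNat C 2).symm
      rw [h2, ← C_mul, ← C_mul, ← C_sub]
      congr 1
      field_simp
      ring
    simp only [zonal, map_sub, Derivation.leibniz, smul_eq_mul, dirDeriv_linForm, hx,
      dirDeriv_normSq, derivation_C, map_one, Derivation.map_one_eq_zero]
    push_cast
    rw [← e]
    simp
    ring
  | k + 2 => by
    have h3 : (3 : ℝ) ≤ n := by exact_mod_cast hn
    have hk : (0 : ℝ) ≤ k := Nat.cast_nonneg k
    have d0 : (k : ℝ) + n - 1 ≠ 0 := by linarith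
    have d1 : (k : ℝ) + 1 + n - 1 ≠ 0 := by linarith
    have ih1 := dirDeriv_zonal hn hx (k + 1)
    have ih0 := dirDeriv_zonal hn hx k
    have hz : zonal x (k + 3) =
      C ((2 * ((k : ℝ) + 1) + n) / (k + 1 + n - 1)) * (linForm x * zonal x (k + 2)) -
      C (((k : ℝ) + 1 + 1) / (k + 1 + n - 1)) * (normSq (Fin n) * zonal x (k + 1)) := by
      rw [zonal]; push_cast; rfl
    have hz2 : zonal x (k + 2) =
      C ((2 * (k : ℝ) + n) / (k + n - 1)) * (linForm x * zonal x (k + 1)) -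
      C (((k : ℝ) + 1) / (k + n - 1)) * (normSq (Fin n) * zonal x k) := by
      rw [zonal]
    have e1 : (C (((2 * ((k : ℝ) + 1) + n) / (k + 1 + n - 1)) * ((k : ℝ) + 1 + 1) -
        (((k : ℝ) + 1 + 1) / (k + 1 + n - 1)) * 2) : MvPolynomial (Fin n) ℝ) =
        C (((k : ℝ) + 3 - ((2 * ((k : ℝ) + 1) + n) / (k + 1 + n - 1))) *
          ((2 * (k : ℝ) + n) / (k + n - 1))) := by
      congr 1
      field_simp
      ring
    have e2 : (C ((((k : ℝ) + 1 + 1) / (k + 1 + n - 1)) * ((k : ℝ) + 1)) :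
        MvPolynomial (Fin n) ℝ) =
        C (((k : ℝ) + 3 - ((2 * ((k : ℝ) + 1) + n) / (k + 1 + n - 1))) *
          (((k : ℝ) + 1) / (k + n - 1))) := by
      congr 1
      field_simp
      ring
    have h2 : (2 : MvPolynomial (Fin n) ℝ) = C 2 := (map_ofNat C 2).symm
    rw [show k + 2 + 1 = k + 3 by ring, hz]
    simp only [map_sub, Derivation.leibniz, smul_eq_mul, dirDeriv_linForm, hx,
      dirDeriv_normSq, derivation_C, map_one, ih1, ih0]
    push_cast
    simp only [C_mul, C_sub] at e1 e2
    -- Only part of the multiple of `zonal x (k + 2)` is to be expanded by the recurrence: the rest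
    -- matches the term from differentiating `linForm x`. Then `e1` and `e2` compare the
    -- coefficients of `linForm x * zonal x (k + 1)` and `normSq * zonal x k`.
    have hs : (C ((k : ℝ) + 2 + 1) : MvPolynomial (Fin n) ℝ) * zonal x (k + 2) =
        C ((2 * ((k : ℝ) + 1) + n) / (k + 1 + n - 1)) * zonal x (k + 2) +
        (C ((k : ℝ) + 3) - C ((2 * ((k : ℝ) + 1) + n) / (k + 1 + n - 1))) * zonal x (k + 2) := by
      rw [show (k : ℝ) + 2 + 1 = k + 3 by ring]; ring
    rw [hs]
    nth_rewrite 4 [hz2]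
    rw [h2]
    linear_combination (linForm x * zonal x (k + 1)) * e1 - (normSq (Fin n) * zonal x k) * e2

/-- Both terms of the recurrence have a Laplacian proportional to `zonal x k`, by the derivative
formula along the axis and by Euler's identity; the recurrence coefficients make the two cancel. -/
theorem laplacian_zonal (hn : 3 ≤ n) (hx : ∑ i, x i ^ 2 = 1) :
    ∀ k, laplacian (zonal x k) = 0
  | 0 => by simp [laplacian_apply, zonal]
  | 1 => by simp [laplacian_apply, zonal, pderiv_linForm]
  | k + 2 => by
    have h3 : (3 : ℝ) ≤ n := by exact_mod_cast hn
    have hk : (0 : ℝ) ≤ k := Nat.cast_nonneg k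
    have d0 : (k : ℝ) + n - 1 ≠ 0 := by linarith
    rw [zonal, ← smul_eq_C_mul, ← smul_eq_C_mul, map_sub, map_smul, map_smul,
      laplacian_linForm_mul, laplacian_normSq_mul, laplacian_zonal hn hx (k + 1),
      laplacian_zonal hn hx k, (isHomogeneous_zonal x k).sum_X_mul_pderiv,
      dirDeriv_zonal x hn hx k, smul_eq_C_mul, smul_eq_C_mul]
    have e : (C (((2 * (k : ℝ) + n) / (k + n - 1)) * (2 * (k + 1))) : MvPolynomial (Fin n) ℝ) =
        C ((((k : ℝ) + 1) / (k + n - 1)) * (4 * k + 2 * n)) := by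
      congr 1
      field_simp
      ring
    simp only [C_mul, C_add, map_ofNat, map_natCast, nsmul_eq_mul, Fintype.card_fin] at e ⊢
    linear_combination (zonal x k) * e

/-- The zonal harmonic with axis `x` represents the evaluation at `x` on harmonic forms. -/
theorem exists_fischer_zonal (hn : 3 ≤ n) : ∀ k, ∃ c : ℝ, 0 < c ∧
    ∀ (x : Fin n → ℝ) (q : MvPolynomial (Fin n) ℝ), q.IsHomogeneous k → laplacian q = 0 →
      fischer q (zonal x k) = c * eval x q
  | 0 => by
    refine ⟨1, one_pos, fun x q hq _ => ?_⟩
    have : q = C (coeff 0 q) := by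
      rw [← totalDegree_eq_zero_iff_eq_C]
      exact Nat.le_zero.mp hq.totalDegree_le
    rw [zonal, fischer_one, this]
    simp
  | 1 => by
    refine ⟨1, one_pos, fun x q hq _ => ?_⟩
    have h := fischer_linForm_mul x q 1
    rw [mul_one] at h
    have h0 : dirDeriv x q = C (coeff 0 (dirDeriv x q)) := by
      rw [← totalDegree_eq_zero_iff_eq_C]
      exact Nat.le_zero.mp (isHomogeneous_dirDeriv x (k := 0) hq).totalDegree_le
    have he := eval_dirDeriv x hq
    rw [zonal, h, fischer_one]
    rw [h0, eval_C] at he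
    rw [constantCoeff_eq, he]
    simp
  | k + 2 => by
    obtain ⟨c, hc, ih⟩ := exists_fischer_zonal hn (k + 1)
    have h3 : (3 : ℝ) ≤ n := by exact_mod_cast hn
    have hk : (0 : ℝ) ≤ k := Nat.cast_nonneg k
    have d0 : 0 < (k : ℝ) + n - 1 := by linarith
    have d1 : 0 < 2 * (k : ℝ) + n := by linarith
    refine ⟨(2 * (k : ℝ) + n) / (k + n - 1) * c * (k + 2), by positivity, fun x q hq hl => ?_⟩
    -- Taking adjoints, the `normSq` term vanishes as `q` is harmonic. The `linForm` term pairs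
    -- `dirDeriv x q`, harmonic of degree one less, whose value at `x` is `(k + 2) q(x)` by Euler.
    rw [zonal, ← smul_eq_C_mul, ← smul_eq_C_mul, map_sub, map_smul, map_smul,
      fischer_linForm_mul, fischer_normSq_mul, hl,
      ih x _ (isHomogeneous_dirDeriv x hq) (by rw [dirDeriv_laplacian, hl, map_zero]),
      eval_dirDeriv x hq]
    have hz : fischer (0 : MvPolynomial (Fin n) ℝ) (zonal x k) = 0 := by
      simpa using fischer_smul_left 0 0 (zonal x k)
    rw [hz]
    simp only [smul_eq_mul]
    push_cast
    ring

/-- The Gegenbauer polynomials are positive definite on the sphere. -/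
theorem sum_gegenbauer_nonneg (hn : 3 ≤ n) (k : ℕ) {ι : Type*} [Fintype ι]
    (v : ι → EuclideanSpace ℝ (Fin n)) (hv : ∀ i, ‖v i‖ = 1) :
    0 ≤ ∑ i, ∑ j, (gegenbauer n k).eval (inner ℝ (v i) (v j)) := by
  have hsq : ∀ i, ∑ a, (v i a) ^ 2 = 1 := fun i => by
    rw [← EuclideanSpace.real_norm_sq_eq, hv, one_pow]
  obtain ⟨c, hc, h⟩ := exists_fischer_zonal hn k
  -- Since the factor `c` does not depend on the axis, pairing `q` with each of its own summands
  -- gives `c` times the whole Gram sum.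
  set q : MvPolynomial (Fin n) ℝ := ∑ j, zonal (fun a => v j a) k with hq
  have hq1 : q.IsHomogeneous k := IsHomogeneous.sum _ _ _ fun j _ => isHomogeneous_zonal _ k
  have hq2 : laplacian q = 0 := by
    rw [hq, map_sum]
    exact Finset.sum_eq_zero fun j _ => laplacian_zonal _ hn (hsq j) k
  have key : fischer q q = c * ∑ i, ∑ j, (gegenbauer n k).eval (inner ℝ (v i) (v j)) := by
    nth_rewrite 2 [hq]
    rw [map_sum, Finset.mul_sum]
    refine Finset.sum_congr rfl fun i _ => ?_
    rw [h _ q hq1 hq2, hq, map_sum]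
    congr 1
    refine Finset.sum_congr rfl fun j _ => ?_
    rw [eval_zonal _ (hsq i)]
    congr 1
  have := fischer_self_nonneg q
  rw [key] at this
  exact nonneg_of_mul_nonneg_right this hc

end Zonal

/-! ### Sums of `fAlpha` and linear programming certificates -/

/-- At most few points of a spherical code are far from a given point: if `z` bounds the inner
products of the distinct points of `s`, and their inner products with `v` are at most `-√z`, then
`∑ (⟨v, w i⟩² - z) ≤ 1 - z`. -/
theorem sum_sq_sub_le {E ι : Type*} [NormedAddCommGroup E] [InnerProductSpace ℝ E]
    {z : ℝ} (hz0 : 0 ≤ z) (hz1 : z < 1) (s : Finset ι) (w : ι → E) (v : E)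
    (hv : ‖v‖ = 1) (hw : ∀ i, ‖w i‖ = 1) (hww : ∀ i j, i ≠ j → inner ℝ (w i) (w j) ≤ z)
    (hvw : ∀ i ∈ s, inner ℝ v (w i) ≤ 0) :
    ∑ i ∈ s, ((inner ℝ v (w i)) ^ 2 - z) ≤ 1 - z := by
  classical
  set a : ι → ℝ := fun i => -inner ℝ v (w i) with ha
  set A := ∑ i ∈ s, a i ^ 2 with hA
  have ha0 : ∀ i ∈ s, 0 ≤ a i := fun i hi => by simpa [ha] using hvw i hi
  have hA0 : 0 ≤ A := Finset.sum_nonneg fun i _ => sq_nonneg _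
  -- Cauchy-Schwarz is applied to `v` and this combination, whose inner product with `v` is `-A`; so
  -- `A² ≤ ‖y‖²`.
  set y := ∑ i ∈ s, a i • w i with hy
  have hvy : inner ℝ v y = -A := by
    rw [hy, inner_sum, hA, ← Finset.sum_neg_distrib]
    refine Finset.sum_congr rfl fun i _ => ?_
    rw [inner_smul_right]
    simp only [ha]
    ring
  have hcs : A ^ 2 ≤ inner ℝ y y := by
    have h := abs_real_inner_le_norm v y
    rw [hvy, hv, one_mul, abs_neg, abs_of_nonneg hA0] at h
    rw [real_inner_self_eq_norm_sq]
    exact pow_le_pow_left₀ hA0 h 2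
  have hyy : inner ℝ y y ≤ (1 - z) * A + z * (∑ i ∈ s, a i) ^ 2 := by
    have h1 : inner ℝ y y = ∑ i ∈ s, ∑ j ∈ s, a i * a j * inner ℝ (w i) (w j) := by
      rw [hy, sum_inner]
      refine Finset.sum_congr rfl fun i _ => ?_
      rw [inner_sum]
      refine Finset.sum_congr rfl fun j _ => ?_
      rw [inner_smul_left, inner_smul_right]
      simp
      ring
    -- Written as a double sum, the bound compares entry by entry: off the diagonal `⟨w i, w j⟩ ≤ z`
    -- with nonnegative weights, on it equality.
    have h2 : (1 - z) * A + z * (∑ i ∈ s, a i) ^ 2 =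
        ∑ i ∈ s, ∑ j ∈ s, (a i * a j * z + if i = j then (1 - z) * a i ^ 2 else 0) := by
      simp only [Finset.sum_add_distrib, ← Finset.sum_mul, ← Finset.mul_sum, Finset.sum_ite_eq]
      rw [Finset.sum_ite_of_true (fun i hi => hi), ← Finset.mul_sum]
      ring
    rw [h1, h2]
    refine Finset.sum_le_sum fun i hi => Finset.sum_le_sum fun j hj => ?_
    split_ifs with hij
    · subst hij
      rw [real_inner_self_eq_norm_sq, hw]
      exact le_of_eq (by ring)
    · rw [add_zero]
      exact mul_le_mul_of_nonneg_left (hww i j hij) (mul_nonneg (ha0 i hi) (ha0 j hj))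
  have hsum : (∑ i ∈ s, a i) ^ 2 ≤ s.card * A := sq_sum_le_card_mul_sum_sq
  have hfin : A ≤ 1 - z + z * s.card := by
    rcases hA0.eq_or_lt with h | h
    · rw [← h]
      have : 0 ≤ z * s.card := by positivity
      linarith
    · have : A * A ≤ (1 - z + z * s.card) * A := by
        nlinarith [mul_le_mul_of_nonneg_left hsum hz0]
      exact le_of_mul_le_mul_right this h
  have : ∑ i ∈ s, ((inner ℝ v (w i)) ^ 2 - z) = A - z * s.card := by
    simp [hA, ha, Finset.sum_sub_distrib, mul_comm]
  linarith

/-- Inner products of distinct points never exceed `cos α`, so only the diagonal entry is positive,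
with value 1. The points below `-√(cos α)` contribute at least `-1` together. -/
theorem sum_fAlpha_nonneg {E ι : Type*} [NormedAddCommGroup E] [InnerProductSpace ℝ E] [Fintype ι]
    {α : ℝ} (h0 : 0 ≤ Real.cos α) (h1 : Real.cos α < 1) (w : ι → E) (hw : ∀ i, ‖w i‖ = 1)
    (hww : ∀ i j, i ≠ j → inner ℝ (w i) (w j) ≤ Real.cos α) (i : ι) :
    0 ≤ ∑ j, fAlpha α (inner ℝ (w i) (w j)) := by
  classical
  set z := Real.cos α with hz
  have hz1 : 0 < 1 - z := by linarith
  have hs : 0 ≤ √z := Real.sqrt_nonneg z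
  set s := Finset.univ.filter fun j => inner ℝ (w i) (w j) < -√z with hs_def
  have hle := sum_sq_sub_le h0 h1 s w (w i) (hw i) hw hww fun j hj => by
    have := (Finset.mem_filter.mp hj).2
    linarith
  have key : ∑ j, fAlpha α (inner ℝ (w i) (w j)) =
      ∑ j, ((if inner ℝ (w i) (w j) < -√z then -((inner ℝ (w i) (w j)) ^ 2 - z) / (1 - z) else 0) +
        if i = j then 1 else 0) := by
    refine Finset.sum_congr rfl fun j _ => ?_
    by_cases hij : i = j
    · subst hij
      have hself : inner ℝ (w i) (w i) = (1 : ℝ) := by rw [real_inner_self_eq_norm_sq, hw]; norm_num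
      rw [fAlpha, hself, if_neg (by linarith), if_neg (by linarith), if_neg (by linarith), if_pos rfl,
        div_self hz1.ne', zero_add]
    · rw [fAlpha, if_neg hij, add_zero, if_pos (hww i j hij)]
      split_ifs
      · rw [neg_sub]
      · rfl
  rw [key, Finset.sum_add_distrib, ← Finset.sum_filter, ← hs_def, ← Finset.sum_div,
    Finset.sum_neg_distrib]
  simp only [Finset.sum_ite_eq, Finset.mem_univ, if_true]
  have : (∑ j ∈ s, ((inner ℝ (w i) (w j)) ^ 2 - z)) / (1 - z) ≤ 1 := (div_le_one hz1).mpr hle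
  rw [neg_div]
  linarith

theorem inner_le_cos_of_le_angle {E : Type*} [NormedAddCommGroup E] [InnerProductSpace ℝ E]
    {x y : E} (hx : ‖x‖ = 1) (hy : ‖y‖ = 1) {α : ℝ} (h0 : 0 ≤ α)
    (h : α ≤ InnerProductGeometry.angle x y) : inner ℝ x y ≤ Real.cos α := by
  have := Real.cos_le_cos_of_nonneg_of_le_pi h0 (InnerProductGeometry.angle_le_pi x y) h
  rwa [InnerProductGeometry.cos_angle, hx, hy, one_mul, div_one] at this

theorem sum_combination_nonneg {n : ℕ} (hn : 3 ≤ n) {cf : ℝ} (hcf : 0 ≤ cf) {c : Fin 15 → ℝ}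
    (hc : ∀ i, 0 ≤ c i) {N : ℕ} {x : Fin N → EuclideanSpace ℝ (Fin n)}
    (hx : IsSphericalCode (Real.pi / 3) x) :
    0 ≤ ∑ i, ∑ j, combination n cf c (inner ℝ (x i) (x j)) := by
  have hpi : 0 ≤ Real.pi / 3 := by positivity
  have h1 : ∀ i, 0 ≤ ∑ j, fAlpha (Real.pi / 3) (inner ℝ (x i) (x j)) :=
    sum_fAlpha_nonneg (by rw [Real.cos_pi_div_three]; norm_num)
      (by rw [Real.cos_pi_div_three]; norm_num) x hx.2.1
      fun i j hij => inner_le_cos_of_le_angle (hx.2.1 i) (hx.2.1 j) hpi (hx.2.2 i j hij)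
  have key : ∑ i, ∑ j, combination n cf c (inner ℝ (x i) (x j)) =
      cf * (∑ i, ∑ j, fAlpha (Real.pi / 3) (inner ℝ (x i) (x j))) +
      ∑ k : Fin 15, c k *
        ∑ i, ∑ j, (gegenbauer n ((k : ℕ) + 1)).eval (inner ℝ (x i) (x j)) := by
    simp only [combination, Finset.sum_add_distrib, Finset.mul_sum]
    congr 1
    rw [Finset.sum_comm]
    simp only [Finset.sum_comm (t := (Finset.univ : Finset (Fin 15)))]
    exact Finset.sum_congr rfl fun _ _ => Finset.sum_comm
  rw [key]
  refine add_nonneg (mul_nonneg hcf (Finset.sum_nonneg fun i _ => h1 i))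
    (Finset.sum_nonneg fun k _ => mul_nonneg (hc k) (sum_gegenbauer_nonneg hn _ x hx.2.1))

/-! ### From certificates to bounds on codes and kissing numbers -/

/-- A certificate bounds the size of every spherical code. -/
theorem IsCertificate.card_le {n B : ℕ} {f : ℝ → ℝ} (hf : IsCertificate n B f) {N : ℕ}
    {x : Fin N → EuclideanSpace ℝ (Fin n)} (hx : IsSphericalCode (Real.pi / 3) x) : N ≤ B := by
  obtain ⟨c, hc, hcB, hsum, hle, hone⟩ := hf
  have hterm : ∀ i j, f (inner ℝ (x i) (x j)) + c ≤ if i = j then 1 else 0 := fun i j => by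
    split_ifs with hij
    · subst hij
      rwa [real_inner_self_eq_norm_sq, hx.2.1, one_pow]
    · refine hle _ ⟨?_, inner_le_cos_of_le_angle (hx.2.1 i) (hx.2.1 j) (by positivity)
        (hx.2.2 i j hij)⟩
      have := (abs_le.mp (abs_real_inner_le_norm (x i) (x j))).1
      rwa [hx.2.1, hx.2.1, one_mul] at this
  have h := Finset.sum_le_sum fun i (_ : i ∈ Finset.univ) =>
    Finset.sum_le_sum fun j (_ : j ∈ Finset.univ) => hterm i j
  simp only [Finset.sum_add_distrib, Finset.sum_ite_eq, Finset.mem_univ, if_true, Finset.sum_const,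
    Finset.card_univ, Fintype.card_fin, nsmul_eq_mul, mul_one] at h
  have h2 : (N : ℝ) * (N * c) ≤ N := by linarith [hsum N x hx]
  rcases Nat.eq_zero_or_pos N with h0 | h0
  · simp [h0]
  have hN : (0 : ℝ) < N := by exact_mod_cast h0
  have h3 : (N : ℝ) * c ≤ 1 := by nlinarith
  have h4 : (N : ℝ) < B + 1 := lt_of_le_of_lt ((le_div_iff₀ hc).mpr h3) hcB
  exact Nat.lt_succ_iff.mp (by exact_mod_cast h4)

/-- The centres of a kissing configuration have norm `2`. -/
theorem IsKissingConfiguration.norm_eq {n : ℕ} {C : Set (EuclideanSpace ℝ (Fin n))}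
    (hC : IsKissingConfiguration n C) {y : EuclideanSpace ℝ (Fin n)} (hy : y ∈ C) : ‖y‖ = 2 := by
  obtain ⟨⟨p, hp1, hp2⟩, hd⟩ := hC.1 y hy
  refine le_antisymm ?_ ?_
  · rw [← dist_zero_right]
    have := dist_triangle_left y 0 p
    rw [Metric.mem_closedBall] at hp1 hp2
    linarith
  · have := (disjoint_ball_ball_iff one_pos one_pos).mp hd
    rw [dist_zero_right] at this
    linarith

/-- A kissing configuration, scaled to the unit sphere, is a spherical code of angle `π / 3`. -/
theorem IsKissingConfiguration.isSphericalCode {n N : ℕ} {C : Set (EuclideanSpace ℝ (Fin n))}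
    (hC : IsKissingConfiguration n C) {y : Fin N → EuclideanSpace ℝ (Fin n)}
    (hy : ∀ i, y i ∈ C) (hinj : Function.Injective y) :
    IsSphericalCode (Real.pi / 3) fun i => (2⁻¹ : ℝ) • y i := by
  refine ⟨fun i j hij => hinj (smul_right_injective _ (by norm_num) hij), fun i => ?_,
    fun i j hij => ?_⟩
  · rw [norm_smul, hC.norm_eq (hy i)]
    norm_num
  · have hne : y i ≠ y j := fun h => hij (hinj h)
    have hd := (disjoint_ball_ball_iff one_pos one_pos).mp (hC.2 (hy i) (hy j) hne)
    rw [dist_eq_norm] at hd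
    have hsq := norm_sub_sq_real (y i) (y j)
    rw [hC.norm_eq (hy i), hC.norm_eq (hy j)] at hsq
    rw [InnerProductGeometry.angle_smul_smul (by norm_num), InnerProductGeometry.angle,
      hC.norm_eq (hy i), hC.norm_eq (hy j), ← Real.arccos_cos (x := Real.pi / 3) (by positivity)
        (by linarith [Real.pi_pos]), Real.cos_pi_div_three]
    refine Real.arccos_le_arccos ?_
    -- Norms 2 and distance at least 2 give `4 ≤ 8 - 2⟨y i, y j⟩`, so the cosine is at most `2 / 4`.
    have : (2 : ℝ) ^ 2 ≤ ‖y i - y j‖ ^ 2 := pow_le_pow_left₀ (by norm_num) (by linarith) 2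
    rw [div_le_iff₀ (by norm_num)]
    linarith

theorem IsCertificate.kissingNumber_le {n B : ℕ} {f : ℝ → ℝ} (hf : IsCertificate n B f) :
    kissingNumber n ≤ B := by
  refine iSup₂_le fun C hC => ?_
  by_contra! hlt
  -- The configuration is not known to be finite, so a subset of exactly `B + 1` centres is used.
  obtain ⟨D, hDC, hD⟩ := Set.exists_subset_encard_eq (Order.add_one_le_of_lt hlt)
  have hDfin : D.Finite := Set.finite_of_encard_eq_coe (k := B + 1) (by rw [hD]; norm_cast)
  have hcard : hDfin.toFinset.card = B + 1 := by
    rw [hDfin.encard_eq_coe_toFinset_card] at hD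
    exact_mod_cast hD
  let e := hDfin.toFinset.equivFinOfCardEq hcard
  have hmem : ∀ i, (e.symm i : EuclideanSpace ℝ (Fin n)) ∈ C := fun i =>
    hDC (hDfin.mem_toFinset.mp (e.symm i).2)
  have := hf.card_le (hC.isSphericalCode hmem (Subtype.val_injective.comp e.symm.injective))
  omega

/-! ### Certified sign of polynomials with rational coefficients -/

section Lists

variable {R : Type*} [CommRing R] [Algebra R ℝ]

/-- The value at `x` of the polynomial with the coefficients `l`, constant coefficient first. -/
def listEval (x : ℝ) : List R → ℝ
  | [] => 0
  | a :: l => algebraMap R ℝ a + x * listEval x l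

/-- Sum of coefficient lists. -/
def listAdd {R : Type*} [Add R] : List R → List R → List R
  | [], m => m
  | a :: l, [] => a :: l
  | a :: l, b :: m => (a + b) :: listAdd l m

/-- Multiplication of a coefficient list by a scalar. -/
def listSMul {R : Type*} [Mul R] (c : R) : List R → List R
  | [] => []
  | a :: l => c * a :: listSMul c l

/-- Substitution of `1 + X` in a coefficient list. -/
def listShift {R : Type*} [Add R] : List R → List R
  | [] => []
  | c :: l => listAdd (c :: listShift l) (listShift l)

theorem listEval_add (x : ℝ) :
    ∀ l m : List R, listEval x (listAdd l m) = listEval x l + listEval x m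
  | [], m => by simp [listAdd, listEval]
  | a :: l, [] => by simp [listAdd, listEval]
  | a :: l, b :: m => by
    simp only [listAdd, listEval, listEval_add x l m, map_add]
    ring

theorem listEval_smul (x : ℝ) (c : R) :
    ∀ l, listEval x (listSMul c l) = algebraMap R ℝ c * listEval x l
  | [] => by simp [listSMul, listEval]
  | a :: l => by
    simp only [listSMul, listEval, listEval_smul x c l, map_mul]
    ring

theorem listEval_shift (x : ℝ) : ∀ l : List R, listEval x (listShift l) = listEval (1 + x) l
  | [] => rfl
  | c :: l => by
    simp only [listShift, listEval_add, listEval, listEval_shift x l]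
    ring

theorem listEval_append (x : ℝ) (m : List R) :
    ∀ l, listEval x (l ++ m) = listEval x l + x ^ l.length * listEval x m
  | [] => by simp [listEval]
  | a :: l => by
    simp only [List.cons_append, listEval, listEval_append x m l, List.length_cons, pow_succ]
    ring

/-- Reversal is `p ↦ X^d p(1/X)`. The length is `d + 1`, hence the extra factor `x` on the right; it
avoids subtraction of exponents and a special case for the empty list. -/
theorem listEval_reverse {x : ℝ} (hx : x ≠ 0) :
    ∀ l : List R, x ^ l.length * listEval x⁻¹ l.reverse = x * listEval x l
  | [] => by simp [listEval]
  | a :: l => by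
    have ih := listEval_reverse hx l
    have h : x ^ (l.length + 1) * (x⁻¹ ^ l.length * algebraMap R ℝ a) = x * algebraMap R ℝ a := by
      rw [pow_succ, inv_pow]
      field_simp
    simp only [List.reverse_cons, listEval_append, listEval, List.length_cons,
      List.length_reverse, mul_zero, add_zero, mul_add]
    rw [h, pow_succ]
    linear_combination x * ih

end Lists

/-- Substitution of `a + b X` in a coefficient list. -/
def listComp (a b : ℚ) : List ℚ → List ℚ
  | [] => []
  | c :: l => listAdd (c :: listSMul b (listComp a b l)) (listSMul a (listComp a b l))

theorem listEval_comp (x : ℝ) (a b : ℚ) :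
    ∀ l, listEval x (listComp a b l) = listEval (a + b * x) l
  | [] => rfl
  | c :: l => by
    simp only [listComp, listEval_add, listEval_smul, listEval_comp x a b l, listEval, eq_ratCast]
    ring

theorem listEval_nonneg {x : ℝ} (hx : 0 ≤ x) :
    ∀ {l : List ℤ}, (l.all fun a => decide (0 ≤ a)) = true → 0 ≤ listEval x l
  | [], _ => le_rfl
  | a :: l, h => by
    simp only [List.all_cons, Bool.and_eq_true, decide_eq_true_eq] at h
    have ha : (0 : ℝ) ≤ a := by exact_mod_cast h.1
    exact add_nonneg (by simpa using ha) (mul_nonneg hx (listEval_nonneg hx h.2))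

/-- A sufficient condition for a polynomial to be nonnegative on `[0, 1]`: the coefficients of
`(1 + X)^d p (1 / (1 + X))` are nonnegative. -/
def descartesNonneg (l : List ℤ) : Bool :=
  decide (0 ≤ l.headD 0) && (listShift l.reverse).all fun a => decide (0 ≤ a)

theorem listEval_nonneg_of_descartesNonneg {l : List ℤ} (h : descartesNonneg l = true) {x : ℝ}
    (hx0 : 0 ≤ x) (hx1 : x ≤ 1) : 0 ≤ listEval x l := by
  simp only [descartesNonneg, Bool.and_eq_true, decide_eq_true_eq] at h
  rcases hx0.eq_or_lt with rfl | hx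
  · cases l with
    | nil => exact le_rfl
    | cons a l =>
      have : (0 : ℝ) ≤ a := by exact_mod_cast h.1
      simpa [listEval] using this
  -- Here `x = 1 / (1 + y)` with `y = x⁻¹ - 1 ≥ 0`; the point `x = 0` is not of this form and was
  -- treated by the constant coefficient.
  · have hy : 0 ≤ x⁻¹ - 1 := by linarith [(one_le_inv₀ hx).mpr hx1]
    have h2 := listEval_nonneg hy h.2
    rw [listEval_shift, add_sub_cancel] at h2
    have h3 : 0 ≤ x * listEval x l := by
      rw [← listEval_reverse hx.ne']
      positivity
    exact nonneg_of_mul_nonneg_right h3 hx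

/-- The coefficients of `2^d p (X / 2)`, where `d + 1` is the length of the list. -/
def listHalve : List ℤ → List ℤ
  | [] => []
  | c :: l => 2 ^ l.length * c :: listHalve l

theorem listEval_halve (x : ℝ) :
    ∀ l, 2 * listEval x (listHalve l) = 2 ^ l.length * listEval (x / 2) l
  | [] => by simp [listHalve, listEval]
  | c :: l => by
    have ih := listEval_halve x l
    simp only [listHalve, listEval, List.length_cons, pow_succ, map_mul, map_pow, map_ofNat]
    linear_combination x * ih

/-- Nonnegativity of a polynomial on `[0, 1]`, by bisection down to the given depth. -/
def unitNonneg : ℕ → List ℤ → Bool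
  | 0, l => descartesNonneg l
  | d + 1, l => descartesNonneg l ||
      (unitNonneg d (listHalve l) && unitNonneg d (listShift (listHalve l)))

theorem listEval_nonneg_of_unitNonneg : ∀ {d : ℕ} {l : List ℤ},
    unitNonneg d l = true → ∀ {x : ℝ}, 0 ≤ x → x ≤ 1 → 0 ≤ listEval x l
  | 0, _, h, _, hx0, hx1 => listEval_nonneg_of_descartesNonneg h hx0 hx1
  | d + 1, l, h, x, hx0, hx1 => by
    rw [unitNonneg, Bool.or_eq_true, Bool.and_eq_true] at h
    rcases h with h | ⟨hl, hr⟩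
    · exact listEval_nonneg_of_descartesNonneg h hx0 hx1
    · have h2 : 0 ≤ 2 ^ l.length * listEval x l := by
        have e := listEval_halve (2 * x) l
        rw [mul_div_cancel_left₀ x two_ne_zero] at e
        rw [← e]
        -- The two halves of `[0, 1]` are rescaled to `[0, 1]` by `2x` and `2x - 1`.
        rcases le_total (2 * x) 1 with hx | hx
        · have := listEval_nonneg_of_unitNonneg hl (x := 2 * x) (by linarith) hx
          positivity
        · have := listEval_nonneg_of_unitNonneg hr (x := 2 * x - 1) (by linarith) (by linarith)
          rw [listEval_shift, add_sub_cancel] at this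
          positivity
      exact nonneg_of_mul_nonneg_right h2 (by positivity)

/-- The least common multiple of the denominators of the coefficients. -/
def listDen (l : List ℚ) : ℕ := l.foldr (fun q D => Nat.lcm q.den D) 1

/-- The numerators of the multiples of the coefficients by `D`. -/
def listNum (D : ℕ) (l : List ℚ) : List ℤ := l.map fun q : ℚ => (q * D).num

/-- Integrality of the scaled coefficients is tested by computation, so no property of `listDen` as
a common multiple has to be proved. -/
theorem listEval_listNum (x : ℝ) (D : ℕ) : ∀ {l : List ℚ},
    (l.all fun q => (q * D).den == 1) = true → listEval x (listNum D l) = D * listEval x l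
  | [], _ => by simp [listNum, listEval]
  | q :: l, h => by
    simp only [List.all_cons, Bool.and_eq_true, beq_iff_eq] at h
    have ih := listEval_listNum x D h.2
    have hq : (((q * D).num : ℤ) : ℝ) = q * D := by
      exact_mod_cast Rat.coe_int_num_of_den_eq_one h.1
    rw [listNum] at ih
    simp only [listNum, List.map_cons, listEval, ih, eq_ratCast, eq_intCast, hq]
    ring

/-- Nonnegativity on `[0, 1]` of a polynomial with rational coefficients, by clearing denominators
and bisection. -/
def ratUnitNonneg (d : ℕ) (l : List ℚ) : Bool :=
  decide (0 < listDen l) && (l.all fun q => (q * listDen l).den == 1) &&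
    unitNonneg d (listNum (listDen l) l)

theorem listEval_nonneg_of_ratUnitNonneg {d : ℕ} {l : List ℚ} (h : ratUnitNonneg d l = true)
    {x : ℝ} (hx0 : 0 ≤ x) (hx1 : x ≤ 1) : 0 ≤ listEval x l := by
  simp only [ratUnitNonneg, Bool.and_eq_true, decide_eq_true_eq] at h
  obtain ⟨⟨hD, hden⟩, hn⟩ := h
  have h0 := listEval_nonneg_of_unitNonneg hn hx0 hx1
  rw [listEval_listNum x _ hden] at h0
  exact nonneg_of_mul_nonneg_right h0 (by exact_mod_cast hD)

theorem listEval_nonneg_of_ratUnitNonneg_comp {d : ℕ} {l : List ℚ} {a b : ℚ} (hab : a < b)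
    (h : ratUnitNonneg d (listComp a (b - a) l) = true) {x : ℝ} (hax : (a : ℝ) ≤ x)
    (hxb : x ≤ b) : 0 ≤ listEval x l := by
  have hpos : (0 : ℝ) < b - a := sub_pos.mpr (by exact_mod_cast hab)
  have h0 := listEval_nonneg_of_ratUnitNonneg h (x := (x - a) / (b - a))
    (div_nonneg (by linarith) hpos.le) ((div_le_one hpos).mpr (by linarith))
  rw [listEval_comp] at h0
  have : (a : ℝ) + ((b - a : ℚ) : ℝ) * ((x - a) / (b - a)) = x := by
    push_cast
    field_simp
    ring
  rwa [this] at h0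

/-! ### Coefficients of the combinations of Gegenbauer polynomials -/

/-- One step of the Gegenbauer recurrence on coefficient lists. -/
def gegenbauerStep (n k : ℕ) (p q : List ℚ) : List ℚ :=
  listAdd (0 :: listSMul ((2 * k + n) / (k + n - 1)) q) (listSMul (-((k + 1) / (k + n - 1))) p)

/-- The coefficients of `∑ i, cᵢ G_{k + i}^{(n)}`, from those of `p = G_k` and `q = G_{k + 1}`. -/
def gegenbauerSum (n : ℕ) : List ℚ → ℕ → List ℚ → List ℚ → List ℚ
  | [], _, _, _ => []
  | c :: cs, k, p, q =>
    listAdd (listSMul c p) (gegenbauerSum n cs (k + 1) q (gegenbauerStep n k p q))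

theorem listEval_gegenbauerStep (n k : ℕ) {p q : List ℚ} {x : ℝ}
    (hp : listEval x p = (gegenbauer n k).eval x)
    (hq : listEval x q = (gegenbauer n (k + 1)).eval x) :
    listEval x (gegenbauerStep n k p q) = (gegenbauer n (k + 2)).eval x := by
  rw [gegenbauerStep, gegenbauer]
  simp only [listEval_add, listEval, listEval_smul, hp, hq, eq_ratCast, Polynomial.eval_sub,
    Polynomial.eval_mul, Polynomial.eval_C, Polynomial.eval_X]
  push_cast
  ring

theorem listEval_gegenbauerSum (n : ℕ) (x : ℝ) : ∀ (cs : List ℚ) (k : ℕ) (p q : List ℚ),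
    listEval x p = (gegenbauer n k).eval x → listEval x q = (gegenbauer n (k + 1)).eval x →
    listEval x (gegenbauerSum n cs k p q) =
      ∑ i : Fin cs.length, ((cs.get i : ℚ) : ℝ) * (gegenbauer n (i + k)).eval x
  | [], _, _, _, _, _ => by simp [gegenbauerSum, listEval]
  | c :: cs, k, p, q, hp, hq => by
    rw [gegenbauerSum, listEval_add, listEval_smul, hp, eq_ratCast,
      listEval_gegenbauerSum n x cs (k + 1) q _ hq (listEval_gegenbauerStep n k hp hq)]
    simp only [List.length_cons]
    rw [Fin.sum_univ_succ]
    congr 1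
    · simp
    · refine Finset.sum_congr rfl fun i _ => ?_
      rw [Fin.val_succ, show (i : ℕ) + 1 + k = i + (k + 1) by ring]
      rfl

/-- The coefficients of `-c - ∑ i, cᵢ G_{i + 1}^{(n)}`. -/
def negPart (n : ℕ) (c : ℚ) (cs : List ℚ) : List ℚ :=
  listSMul (-1) (gegenbauerSum n (c :: cs) 0 [1] [0, 1])

/-- Since `G_0 = 1`, the constant `c` enters as the coefficient of index 0. -/
theorem listEval_negPart (n : ℕ) (c : ℚ) (cs : List ℚ) (x : ℝ) :
    listEval x (negPart n c cs) =
      -(c + ∑ i : Fin cs.length, ((cs.get i : ℚ) : ℝ) * (gegenbauer n (i + 1)).eval x) := by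
  rw [negPart, listEval_smul, listEval_gegenbauerSum n x (c :: cs) 0 [1] [0, 1]
    (by simp [listEval, gegenbauer]) (by simp [listEval, gegenbauer])]
  simp only [List.length_cons]
  rw [Fin.sum_univ_succ]
  simp [gegenbauer]

/-- The numerical conditions under which the combination of `fAlpha (π / 3)` and of Gegenbauer
polynomials with the coefficients `cf` and `cs` is a certificate with the constant `c`. -/
def certificateCheck (n B : ℕ) (cf c : ℚ) (cs : List ℚ) : Bool :=
  decide (0 ≤ cf) && cs.all (fun a => decide (0 ≤ a)) && decide (0 < c) &&
  decide (1 < c * (B + 1)) && decide (cf + cs.sum + c ≤ 1) &&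
  -- The fractions `470832/665857` and `195025/275807` approximate `1/√2` from below and above
  -- (solutions of Pell equations). Each rational interval therefore covers its side of `-1/√2`,
  -- with a tiny overlap. The list `[-cf, 0, 2 * cf]` is `-cf (1 - 2t²)`, and 20 bounds the
  -- bisection depth.
  ratUnitNonneg 20 (listComp (-1) (-(470832 / 665857) - -1)
    (listAdd [-cf, 0, 2 * cf] (negPart n c cs))) &&
  ratUnitNonneg 20 (listComp (-(195025 / 275807)) (1 / 2 - -(195025 / 275807)) (negPart n c cs))

theorem isCertificate_of_check {n B : ℕ} (hn : 3 ≤ n) {cf c : ℚ} {cs : List ℚ}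
    (hlen : cs.length = 15) (h : certificateCheck n B cf c cs = true) :
    IsCertificate n B (combination n cf fun i => ((cs.get (i.cast hlen.symm) : ℚ) : ℝ)) := by
  simp only [certificateCheck, Bool.and_eq_true, decide_eq_true_eq] at h
  obtain ⟨⟨⟨⟨⟨⟨hcf, hcs⟩, hc⟩, hcB⟩, hone⟩, hleft⟩, hright⟩ := h
  have hcf' : (0 : ℝ) ≤ cf := by exact_mod_cast hcf
  have hc' : (0 : ℝ) < c := by exact_mod_cast hc
  have hcs' : ∀ i : Fin 15, (0 : ℝ) ≤ ((cs.get (i.cast hlen.symm) : ℚ) : ℝ) := fun i => by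
    have := List.all_eq_true.mp hcs _ (cs.get_mem (i.cast hlen.symm))
    exact_mod_cast of_decide_eq_true this
  have hsum : ∀ g : ℕ → ℝ, ∑ i : Fin 15, ((cs.get (i.cast hlen.symm) : ℚ) : ℝ) * g i =
      ∑ i : Fin cs.length, ((cs.get i : ℚ) : ℝ) * g i := fun g =>
    Fintype.sum_equiv (finCongr hlen.symm) _ _ fun i => rfl
  refine ⟨c, hc', ?_, fun N x hx => sum_combination_nonneg hn hcf' hcs' hx, ?_, ?_⟩
  · rw [div_lt_iff₀ hc', mul_comm]
    exact_mod_cast hcB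
  · intro t ht
    rw [Real.cos_pi_div_three] at ht
    have heval := listEval_negPart n c cs t
    rw [← hsum fun k => (gegenbauer n (k + 1)).eval t] at heval
    rw [combination, fAlpha, Real.cos_pi_div_three]
    split_ifs with h1 h2
    · have hlow : (470832 / 665857 : ℝ) ≤ √(1 / 2) := Real.le_sqrt_of_sq_le (by norm_num)
      have hP := listEval_nonneg_of_ratUnitNonneg_comp (by norm_num) hleft (x := t) (by push_cast; exact ht.1)
        (by push_cast; linarith)
      rw [listEval_add, heval] at hP
      simp only [listEval, eq_ratCast] at hP
      push_cast at hP
      linear_combination hP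
    · have hupp : √(1 / 2 : ℝ) ≤ 195025 / 275807 := Real.sqrt_le_iff.mpr ⟨by norm_num, by norm_num⟩
      have hP := listEval_nonneg_of_ratUnitNonneg_comp (by norm_num) hright (x := t)
        (by push_cast; push Not at h1; linarith) (by push_cast; exact ht.2)
      rw [heval] at hP
      linear_combination hP
    · exact absurd ht.2 h2
  · have hf1 : fAlpha (Real.pi / 3) 1 = 1 := by
      have hs0 := Real.sqrt_nonneg (1 / 2 : ℝ)
      rw [fAlpha, Real.cos_pi_div_three, if_neg (by linarith), if_neg (by norm_num)]
      norm_num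
    have hl : ((cs.sum : ℚ) : ℝ) = ∑ i : Fin cs.length, ((cs.get i : ℚ) : ℝ) := by
      rw [← Rat.cast_sum]
      congr 1
      exact (Fin.sum_univ_getElem cs).symm
    have hone' : (cf : ℝ) + cs.sum + c ≤ 1 := by exact_mod_cast hone
    rw [combination, hf1]
    have := hsum fun _ => 1
    simp only [mul_one] at this
    simp only [gegenbauer_eval_one (show 2 ≤ n by omega), mul_one, this, ← hl]
    exact hone'

/-! ### The five numerical certificates -/

theorem isCertificate_f9 : IsCertificate 9 379 f9 := by
  have h := isCertificate_of_check (n := 9) (B := 379) (by norm_num) (cf := 0.008455)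
    -- Just above `1/380`; in each dimension `c` slightly exceeds `1 / (B + 1)`, as the strict bound
    -- requires.
    (c := 0.0026315789483)
    (cs := [0.019301, 0.068796, 0.151621, 0.233218, 0.242578,
      0.173153, 0.057219, 0, 0, 0.020652,
      0.022367, 0, 0, 0, 0])
    rfl (by decide +kernel)
  convert h using 1
  refine congrArg₂ (combination 9) ?_ (funext fun i => ?_)
  · norm_num
  · fin_cases i <;> norm_num

theorem isCertificate_f16 : IsCertificate 16 8312 f16 := by
  have h := isCertificate_of_check (n := 16) (B := 8312) (by norm_num) (cf := 0.00340331)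
    (c := 0.0001202935171)
    (cs := [0.00150625, 0.00883013, 0.03241271, 0.08357928, 0.15818006,
      0.22396571, 0.22963948, 0.16129212, 0.05703299, 0,
      0, 0.02211528, 0.01792231, 0, 0])
    rfl (by decide +kernel)
  convert h using 1
  refine congrArg₂ (combination 16) ?_ (funext fun i => ?_)
  · norm_num
  · fin_cases i <;> norm_num

theorem isCertificate_f17 : IsCertificate 17 12210 f17 := by
  have h := isCertificate_of_check (n := 17) (B := 12210) (by norm_num) (cf := 0.0024045205)
    (c := 0.0000818933758)
    (cs := [0.0010991163, 0.0068289424, 0.0264586211, 0.0719084276, 0.143361526,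
      0.2142502303, 0.2322459799, 0.17372837, 0.0656867748, 0,
      0, 0.0310430395, 0.0309025515, 0, 0])
    rfl (by decide +kernel)
  convert h using 1
  refine congrArg₂ (combination 17) ?_ (funext fun i => ?_)
  · norm_num
  · fin_cases i <;> norm_num

theorem isCertificate_f25 : IsCertificate 25 278083 f25 := by
  have h := isCertificate_of_check (n := 25) (B := 278083) (by norm_num) (cf := 0.005312502853)
    (c := 0.0000035960367)
    (cs := [0.000068346426, 0.000597204273, 0.003278765311, 0.012746086882, 0.03727450386,
      0.084612203762, 0.149967112742, 0.207792862667, 0.213189306323, 0.15506047251,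
      0.052419478729, 0, 0, 0.038614866776, 0.039062690839])
    rfl (by decide +kernel)
  convert h using 1
  refine congrArg₂ (combination 25) ?_ (funext fun i => ?_)
  · norm_num
  · fin_cases i <;> norm_num

theorem isCertificate_f26 : IsCertificate 26 396447 f26 := by
  have h := isCertificate_of_check (n := 26) (B := 396447) (by norm_num) (cf := 0.00178248638)
    (c := 0.0000025223999)
    (cs := [0.000050764918, 0.000462456224, 0.002637553785, 0.010630533922, 0.032234603849,
      0.07583669717, 0.139668776208, 0.20110760134, 0.216300884031, 0.164792888823,
      0.062508329517, 0, 0, 0.042401423571, 0.04958247785])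
    rfl (by decide +kernel)
  convert h using 1
  refine congrArg₂ (combination 26) ?_ (funext fun i => ?_)
  · norm_num
  · fin_cases i <;> norm_num

end Kissing

end

theorem mainTheorem3 :
    (Kissing.IsCertificate 9 379 Kissing.f9 ∧ Kissing.kissingNumber 9 ≤ 379) ∧
    (Kissing.IsCertificate 16 8312 Kissing.f16 ∧ Kissing.kissingNumber 16 ≤ 8312) ∧
    (Kissing.IsCertificate 17 12210 Kissing.f17 ∧ Kissing.kissingNumber 17 ≤ 12210) ∧
    (Kissing.IsCertificate 25 278083 Kissing.f25 ∧ Kissing.kissingNumber 25 ≤ 278083) ∧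
    (Kissing.IsCertificate 26 396447 Kissing.f26 ∧ Kissing.kissingNumber 26 ≤ 396447) := by
  exact ⟨⟨Kissing.isCertificate_f9, Kissing.isCertificate_f9.kissingNumber_le⟩,
    ⟨Kissing.isCertificate_f16, Kissing.isCertificate_f16.kissingNumber_le⟩,
    ⟨Kissing.isCertificate_f17, Kissing.isCertificate_f17.kissingNumber_le⟩,
    ⟨Kissing.isCertificate_f25, Kissing.isCertificate_f25.kissingNumber_le⟩,
    ⟨Kissing.isCertificate_f26, Kissing.isCertificate_f26.kissingNumber_le⟩⟩
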